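/- Let $K$ be a formally real field. An ordering of $K$ is a subset $P\subset K$ with $P+P\subseteq P$, $P\cdot P\subseteq P$, $-1\notin P$ and $P\cup -P=K$; write $a\le_P b$ for $b-a\in P$. The $\mathbb{R}$-place attached to $P$ is the map $\lambda_P:K\to\mathbb{R}\cup\{\infty\}$ with $\lambda_P(a)=\inf\{r\in\mathbb{Q}\mid a\le_P r\}$ if $-r\le_P a\le_P r$ for some $r\in\mathbb{Q}$, and $\lambda_P(a)=\infty$ otherwise. The space of $\mathbb{R}$-places $M(K)=\{\lambda_P\mid P \text{ an ordering of } K\}$ carries the coarsest topology for which all evaluations $M(K)\to\mathbb{R}\cup\{\infty\}$, $\lambda\mapsto\lambda(a)$ ($a\in K$), are continuous, where $\mathbb{R}\cup\{\infty\}$ is the one-point compactification of $\mathbb{R}$. Let $\sum K^{n}$ be the set of finite sums of $n$-th powers of elements of $K$, let $K^{*2}$ be the group of nonzero squares, and let $(\sum K^{*2})^2$ be the group of squares of nonzero sums of squares; it is a subgroup of $K^{*2}\cap\sum K^4$. Then the number of connected components of $M(K)$ is $$|\pi_0(M(K))| = 1+\log_2\bigl[(K^{*2}\cap\textstyle\sum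 K^4):(\sum K^{*2})^2\bigr].$$ Moreover, let $H(K)$ be the real holomorphy ring of $K$, that is, the intersection of all valuation rings of $K$ with formally real residue field, let $E$ be its group of units and $E^+=E\cap\sum K^2$. Then $$|\pi_0(M(K))|=\log_2[E:E^+],\qquad (K^{*2}\cap\textstyle\sum K^4)/(\sum K^{*2})^2\;\cong\; E/(E^+\cup -E^+).$$ In both formulas cardinalities and indices are taken in $\mathbb{N}\cup\{\infty\}$, with $\log_2\infty=\infty$: one side is finite if and only if the other is, and then they are equal. -/

import Mathlib

namespace RealPlaces

noncomputable section

open scoped Classical in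
/-- The `ℝ`-place `λ_P : K → ℝ ∪ {∞}` attached to an ordering `P` of the field `K`, where
`x ≤_P y` means `y - x ∈ P`. If `-r ≤_P a ≤_P r` for some rational `r`, then
`λ_P(a) = inf {r ∈ ℚ | a ≤_P r}`, the infimum being taken in `ℝ`; otherwise `λ_P(a) = ∞`. -/
def placeOf {K : Type*} [Field K] (P : RingPreordering K) (a : K) : OnePoint ℝ :=
  if ∃ r : ℚ, a - (-(r : K)) ∈ P ∧ (r : K) - a ∈ P then
    ((sInf {x : ℝ | ∃ r : ℚ, (r : K) - a ∈ P ∧ x = (r : ℝ)} : ℝ) : OnePoint ℝ)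
  else OnePoint.infty

/-- The space `M(K) = {λ_P | P an ordering of K}` of `ℝ`-places of `K`. As a subspace of the
product `K → ℝ ∪ {∞}` it carries the coarsest topology for which all the evaluations
`λ ↦ λ(a)`, `a ∈ K`, are continuous. -/
def placeSpace (K : Type*) [Field K] : Set (K → OnePoint ℝ) :=
  {l | ∃ P : RingPreordering K, P.IsOrdering ∧ l = placeOf P}

/-- `∑ K ^ n`: the finite sums of `n`-th powers of elements of `K`. -/
def sumPow (K : Type*) [Field K] (n : ℕ) : AddSubmonoid K :=
  AddSubmonoid.closure (Set.range fun x : K => x ^ n)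

theorem pow_mem_sumPow {K : Type*} [Field K] (n : ℕ) (x : K) : x ^ n ∈ sumPow K n :=
  AddSubmonoid.subset_closure ⟨x, rfl⟩

theorem mul_mem_sumPow {K : Type*} [Field K] (n : ℕ) {x y : K}
    (hx : x ∈ sumPow K n) (hy : y ∈ sumPow K n) : x * y ∈ sumPow K n := by
  induction hx using AddSubmonoid.closure_induction with
  | mem x hx =>
    obtain ⟨a, rfl⟩ := hx
    induction hy using AddSubmonoid.closure_induction with
    | mem y hy =>
      obtain ⟨b, rfl⟩ := hy
      simpa only [mul_pow] using pow_mem_sumPow n (a * b)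
    | zero => simpa only [mul_zero] using zero_mem _
    | add y z _ _ hy hz => simpa only [mul_add] using add_mem hy hz
  | zero => simpa only [zero_mul] using zero_mem _
  | add x z _ _ hx hz => simpa only [add_mul] using add_mem hx hz

theorem one_mem_sumPow {K : Type*} [Field K] (n : ℕ) : (1 : K) ∈ sumPow K n := by
  simpa only [one_pow] using pow_mem_sumPow n (1 : K)

/-- The group `∑ K ^ n ∩ K*` of nonzero sums of `n`-th powers (`n ≠ 0`), in the group `K*`. -/
def unitSumPow (K : Type*) [Field K] (n : ℕ) [NeZero n] : Subgroup Kˣ where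
  carrier := {u | (u : K) ∈ sumPow K n}
  one_mem' := one_mem_sumPow n
  mul_mem' {a b} ha hb := by
    simpa only [Set.mem_ofPred_eq, Units.val_mul] using mul_mem_sumPow n ha hb
  inv_mem' {u} hu := by
    have hpow : ∀ m : ℕ, (u : K) ^ m ∈ sumPow K n := fun m => by
      induction m with
      | zero => simpa only [pow_zero] using one_mem_sumPow n
      | succ m ih => simpa only [pow_succ] using mul_mem_sumPow n ih hu
    have key : ((u⁻¹ : Kˣ) : K) = (u : K) ^ (n - 1) * ((u⁻¹ : Kˣ) : K) ^ n := by
      obtain ⟨m, rfl⟩ := Nat.exists_eq_succ_of_ne_zero (NeZero.ne n)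
      rw [Nat.succ_eq_add_one, Nat.add_sub_cancel, pow_succ, ← mul_assoc, ← mul_pow,
        Units.mul_inv, one_pow, one_mul]
    rw [Set.mem_ofPred_eq, key]
    exact mul_mem_sumPow n (hpow _) (pow_mem_sumPow n _)

/-- The subgroup `K*² ∩ ∑ K⁴` of `K*`. -/
def squaresSumFourth (K : Type*) [Field K] : Subgroup Kˣ :=
  (powMonoidHom 2 : Kˣ →* Kˣ).range ⊓ unitSumPow K 4

/-- The subgroup `(∑ K*²)²` of `K*`: the squares of the nonzero sums of squares. -/
def squaresOfSumSq (K : Type*) [Field K] : Subgroup Kˣ :=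
  (unitSumPow K 2).map (powMonoidHom 2 : Kˣ →* Kˣ)

/-- In characteristic zero `(∑ K*²)²` is contained in `K*² ∩ ∑ K⁴`. -/
theorem squaresOfSumSq_le (K : Type*) [Field K] [CharZero K] :
    squaresOfSumSq K ≤ squaresSumFourth K := by
  have half : (2 : K)⁻¹ ∈ sumPow K 4 := by
    have h : (2 : K)⁻¹ = 8 • (2 : K)⁻¹ ^ 4 := by norm_num
    rw [h]; exact nsmul_mem (pow_mem_sumPow 4 _) 8
  have third : (3 : K)⁻¹ ∈ sumPow K 4 := by
    have h : (3 : K)⁻¹ = 27 • (3 : K)⁻¹ ^ 4 := by norm_num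
    rw [h]; exact nsmul_mem (pow_mem_sumPow 4 _) 27
  have main : ∀ s ∈ sumPow K 2, ∃ t : K, (∀ y : K, y ^ 4 + 6 * y ^ 2 * s + t ∈ sumPow K 4) ∧
      3 * s ^ 2 - t ∈ sumPow K 4 := by
    intro s hs
    induction hs using AddSubmonoid.closure_induction_right with
    | zero =>
      refine ⟨0, fun y => ?_, ?_⟩
      · simpa using pow_mem_sumPow 4 y
      · simp
    | add_right s _ q hq ih =>
      obtain ⟨x, rfl⟩ := hq
      obtain ⟨t, h1, h2⟩ := ih
      refine ⟨t + 6 * x ^ 2 * s + x ^ 4, fun y => ?_, ?_⟩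
      · have h := mul_mem_sumPow 4 half (add_mem (h1 (y + x)) (h1 (y - x)))
        convert h using 1
        field_simp
        ring
      · have h := add_mem h2 (nsmul_mem (pow_mem_sumPow 4 x) 2)
        convert h using 1
        simp only [nsmul_eq_mul, Nat.cast_ofNat]
        ring
  rintro _ ⟨u, hu, rfl⟩
  refine ⟨⟨u, rfl⟩, ?_⟩
  obtain ⟨t, h1, h2⟩ := main u hu
  have h := mul_mem_sumPow 4 third (add_mem (h1 0) h2)
  change ((u ^ 2 : Kˣ) : K) ∈ sumPow K 4
  convert h using 1
  push_cast
  field_simp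
  ring

/-- The real holomorphy ring `H(K)`: the intersection of all valuation rings of `K` whose
residue field is formally real. -/
def holomorphyRing (K : Type*) [Field K] : Subring K :=
  ⨅ A : {A : ValuationSubring K // IsFormallyReal (IsLocalRing.ResidueField A)}, A.1.toSubring

/-- With `E` the group of units of `H(K)`, the subgroup `E⁺ = E ∩ ∑ K²`. -/
def posUnits (K : Type*) [Field K] : Subgroup (holomorphyRing K)ˣ :=
  (unitSumPow K 2).comap (Units.map (holomorphyRing K).subtype.toMonoidHom)

/-- The subgroup `E⁺ ∪ -E⁺` of `E`. -/
def posNegUnits (K : Type*) [Field K] : Subgroup (holomorphyRing K)ˣ where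
  carrier := {e | e ∈ posUnits K ∨ -e ∈ posUnits K}
  one_mem' := Or.inl (one_mem _)
  mul_mem' {a b} ha hb := by
    rcases ha with ha | ha <;> rcases hb with hb | hb
    · exact Or.inl (mul_mem ha hb)
    · exact Or.inr (by simpa only [mul_neg] using mul_mem ha hb)
    · exact Or.inr (by simpa only [neg_mul] using mul_mem ha hb)
    · exact Or.inl (by simpa only [neg_mul_neg] using mul_mem ha hb)
  inv_mem' {a} ha := by
    rcases ha with ha | ha
    · exact Or.inl (inv_mem ha)
    · exact Or.inr (by simpa only [inv_neg] using inv_mem ha)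

end

end RealPlaces

/-!
Write `H` for the real holomorphy ring, `E` for its group of units and `M` for the space of
`ℝ`-places. Everything rests on the evaluation of `H` on `M`.

Elements of `H` are finite at every place, since the finite elements of an ordered field form a
valuation ring with ordered residue field; hence each place restricts to a ring homomorphism
`H → ℝ` (`evalHom`). As `1 / (1 + a²)` and `a / (1 + a²)` lie in `H` for all `a : K`, these
homomorphisms determine the places (`evalHom_injective`). A place depends continuously on its
ordering, and an ultrafilter limit of orderings is an ordering, so `M` is compact. By the theorem of
Stone and Weierstrass the image of `H` is dense in `C(M, ℝ)` (`exists_evalHom_near`).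

Two criteria translate values into algebra. An element of `H` that is positive at all places is a
sum of squares, by Artin's theorem (`mem_sumPow_two_of_forall_evalHom_pos`). An element that
vanishes at no place is a unit, because every valuation ring with formally real residue field is
compatible with some ordering (`isUnit_of_forall_evalHom_ne_zero`). So sending a unit to the set of
places where it is positive identifies `E / E⁺` with the clopen subsets of `M`: surjectivity comes
from approximating the function `±1` attached to a clopen set. If `M` has `n < ∞` components, it has
`2 ^ n` clopen subsets, and otherwise infinitely many; this gives `|π₀(M)| = log₂ [E : E⁺]`.

The isomorphism between the two quotients is induced by `e ↦ e²`, whose kernel is clearly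
`E⁺ ∪ -E⁺`. That `e²` is a sum of fourth powers is `unit_sq_mem_sumPow_four`: approximating
`1 / |e|` by an element of `H` reduces it to units of absolute value close to `1`, where an
explicit identity applies. For surjectivity, let `b² = ∑ xᵢ⁴` and `s = ∑ xᵢ²`. In a valuation ring
with formally real residue field no cancellation occurs in sums of squares, so `b²` and `s²`
have the same value, `b / s` is in `E`, and `b²` is congruent to `(b / s)²`. Finally
`[E⁺ ∪ -E⁺ : E⁺] = 2` relates the two counting formulas.
-/

namespace RealPlaces

variable {K : Type*} [Field K]

/-! ### Orderings of fields and sums of squares -/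

/-- An ordering of a field comes from a linear order compatible with the field operations. -/
theorem exists_linearOrder (P : RingPreordering K) (hP : P.IsOrdering) :
    ∃ (_ : LinearOrder K) (_ : IsStrictOrderedRing K), ∀ x : K, x ∈ P ↔ 0 ≤ x := by
  classical
  let L : LinearOrder K :=
    { le := fun a b => b - a ∈ P
      le_refl := fun a => by simp
      le_trans := fun a b c hab hbc => by simpa using add_mem hab hbc
      le_antisymm := fun a b hab hba => by
        have := RingPreordering.eq_zero_of_mem_of_neg_mem hab (by simpa using hba)
        exact (sub_eq_zero.1 this).symm
      le_total := fun a b => by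
        simpa using mem_or_neg_mem P (b - a)
      toDecidableLE := Classical.decRel _ }
  have key : ∀ x : K, x ∈ P ↔ 0 ≤ x := fun x => by
    change x ∈ P ↔ x - 0 ∈ P
    rw [sub_zero]
  have hadd : IsOrderedAddMonoid K :=
    ⟨fun a b hab c => by change (b + c) - (a + c) ∈ P; rwa [add_sub_add_right_eq_sub],
      fun a b hab c => by change (c + b) - (c + a) ∈ P; rwa [add_sub_add_left_eq_sub]⟩
  have h01 : ZeroLEOneClass K := ⟨(key 1).1 (one_mem P)⟩
  refine ⟨L, IsStrictOrderedRing.of_mul_pos fun a b ha hb => ?_, key⟩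
  exact lt_of_le_of_ne ((key _).1 (mul_mem ((key a).2 ha.le) ((key b).2 hb.le)))
    (mul_ne_zero ha.ne' hb.ne').symm

/-- The preordering `P - P a` generated by a preordering `P` and the negative of some `a ∉ P`. -/
def adjoinNeg (P : RingPreordering K) (a : K) (ha : a ∉ P) : RingPreordering K :=
  RingPreordering.mk' {z | ∃ x ∈ P, ∃ y ∈ P, z = x - a * y}
    (by
      rintro _ _ ⟨x, hx, y, hy, rfl⟩ ⟨x', hx', y', hy', rfl⟩
      exact ⟨x + x', add_mem hx hx', y + y', add_mem hy hy', by ring⟩)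
    (by
      rintro _ _ ⟨x, hx, y, hy, rfl⟩ ⟨x', hx', y', hy', rfl⟩
      exact ⟨x * x' + a * a * (y * y'),
        add_mem (mul_mem hx hx') (mul_mem (P.mul_self_mem a) (mul_mem hy hy')),
        x * y' + x' * y, add_mem (mul_mem hx hy') (mul_mem hx' hy), by ring⟩)
    (fun x => ⟨x * x, P.mul_self_mem x, 0, zero_mem P, by ring⟩)
    (by
      rintro ⟨x, hx, y, hy, h⟩
      have hy0 : y ≠ 0 := by
        rintro rfl
        exact P.neg_one_notMem (by rw [h]; simpa using hx)
      refine ha ?_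
      have : a = (1 + x) * y⁻¹ := by
        field_simp
        linear_combination h
      rw [this]
      exact mul_mem (add_mem (one_mem P) hx) (RingPreordering.inv_mem hy))

theorem le_adjoinNeg (P : RingPreordering K) (a : K) (ha : a ∉ P) : P ≤ adjoinNeg P a ha :=
  fun x hx => ⟨x, hx, 0, zero_mem P, by ring⟩

theorem neg_mem_adjoinNeg (P : RingPreordering K) (a : K) (ha : a ∉ P) :
    -a ∈ adjoinNeg P a ha :=
  ⟨0, zero_mem P, 1, one_mem P, by ring⟩

/-- Every preordering of a field is contained in an ordering. -/
theorem exists_isOrdering_ge (P : RingPreordering K) :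
    ∃ Q : RingPreordering K, Q.IsOrdering ∧ P ≤ Q := by
  obtain ⟨Q, hPQ, hQ⟩ := zorn_le_nonempty_Ici₀ P (fun c _ hc y hy => by
    refine ⟨RingPreordering.mk' {x | ∃ R ∈ c, x ∈ R} ?_ ?_ ?_ ?_, fun R hR x hx => ⟨R, hR, hx⟩⟩
    · rintro u v ⟨R, hR, hu⟩ ⟨S, hS, hv⟩
      rcases hc.total hR hS with h | h
      · exact ⟨S, hS, add_mem (h hu) hv⟩
      · exact ⟨R, hR, add_mem hu (h hv)⟩
    · rintro u v ⟨R, hR, hu⟩ ⟨S, hS, hv⟩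
      rcases hc.total hR hS with h | h
      · exact ⟨S, hS, mul_mem (h hu) hv⟩
      · exact ⟨R, hR, mul_mem hu (h hv)⟩
    · exact fun x => ⟨y, hy, y.mul_self_mem x⟩
    · rintro ⟨R, _, h⟩
      exact R.neg_one_notMem h) P le_rfl
  refine ⟨Q, RingPreordering.isOrdering_iff.2 fun a b hab => ?_, hPQ⟩
  by_contra! h
  have h1 : -a ∈ Q := hQ (le_adjoinNeg Q a h.1) (neg_mem_adjoinNeg Q a h.1)
  have h2 : -b ∈ Q := hQ (le_adjoinNeg Q b h.2) (neg_mem_adjoinNeg Q b h.2)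
  have h3 : a * b = 0 :=
    RingPreordering.eq_zero_of_mem_of_neg_mem (by simpa using mul_mem h1 h2) hab
  rcases mul_eq_zero.1 h3 with h4 | h4
  · exact h.1 (h4 ▸ zero_mem Q)
  · exact h.2 (h4 ▸ zero_mem Q)

theorem mem_sumPow_two_iff {x : K} : x ∈ sumPow K 2 ↔ IsSumSq x := by
  have : sumPow K 2 = AddSubmonoid.sumSq K := by
    rw [sumPow, ← AddSubmonoid.closure_isSquare]
    congr 1
    ext x
    simp [isSquare_iff_exists_sq, eq_comm]
  rw [this, AddSubmonoid.mem_sumSq]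

/-- The sums of squares form a preordering of a formally real field. -/
def sumSqPreordering (K : Type*) [Field K] [IsFormallyReal K] : RingPreordering K :=
  RingPreordering.mk' {x | IsSumSq x} IsSumSq.add IsSumSq.mul IsSumSq.mul_self
    fun h => one_ne_zero (IsFormallyReal.eq_zero_of_isSumSq_of_neg_isSumSq IsSumSq.one h)

/-- Artin's theorem: an element of a formally real field that is nonnegative in all orderings
is a sum of squares. -/
theorem isSumSq_of_forall_mem_isOrdering [IsFormallyReal K] {a : K}
    (h : ∀ P : RingPreordering K, P.IsOrdering → a ∈ P) : IsSumSq a := by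
  by_contra ha
  obtain ⟨Q, hQ, hle⟩ := exists_isOrdering_ge (adjoinNeg (sumSqPreordering K) a ha)
  have h0 := RingPreordering.eq_zero_of_mem_of_neg_mem (h Q hQ) (hle (neg_mem_adjoinNeg _ a ha))
  exact ha (h0 ▸ IsSumSq.zero)

theorem exists_isOrdering (K : Type*) [Field K] [IsFormallyReal K] :
    ∃ P : RingPreordering K, P.IsOrdering :=
  let ⟨Q, hQ, _⟩ := exists_isOrdering_ge (sumSqPreordering K)
  ⟨Q, hQ⟩

/-! ### Real places as ring homomorphisms to the real numbers -/

section

open ArchimedeanClass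

theorem placeOf_mem_placeSpace {P : RingPreordering K} (hP : P.IsOrdering) :
    placeOf P ∈ placeSpace K :=
  ⟨P, hP, rfl⟩

theorem mem_holomorphyRing {a : K} : a ∈ holomorphyRing K ↔
    ∀ A : ValuationSubring K, IsFormallyReal (IsLocalRing.ResidueField A) → a ∈ A := by
  simp [holomorphyRing, Subring.mem_iInf]

section LinearOrder

variable [LinearOrder K] [IsStrictOrderedRing K]

theorem mk_nonneg_iff_exists_rat {a : K} :
    0 ≤ mk a ↔ ∃ r : ℚ, -(r : K) ≤ a ∧ a ≤ r := by
  constructor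
  · intro h
    obtain ⟨n, hn⟩ := exists_nat_ge_of_mk_nonneg (x := |a|) (by simpa using h)
    exact ⟨n, by simpa using abs_le.1 hn⟩
  · rintro ⟨r, h1, h2⟩
    refine le_trans (mk_ratCast_nonneg (R := K) r) ?_
    exact mk_le_mk_of_abs ((abs_le.2 ⟨h1, h2⟩).trans (le_abs_self _))

theorem le_of_ratCast_lt_stdPart {a : K} (ha : 0 ≤ mk a) {r : ℚ} (h : (r : ℝ) < stdPart a) :
    (r : K) < a := by
  by_contra! hc
  have := stdPart_monotoneOn ha (mk_ratCast_nonneg r) hc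
  rw [stdPart_ratCast] at this
  exact absurd h this.not_gt

theorem lt_ratCast_of_stdPart_lt {a : K} (ha : 0 ≤ mk a) {r : ℚ} (h : stdPart a < (r : ℝ)) :
    a < (r : K) := by
  by_contra! hc
  have := stdPart_monotoneOn (mk_ratCast_nonneg r) ha hc
  rw [stdPart_ratCast] at this
  exact absurd h this.not_gt

theorem placeOf_eq_stdPart {P : RingPreordering K} (hP : ∀ x : K, x ∈ P ↔ 0 ≤ x) {a : K}
    (ha : 0 ≤ mk a) : placeOf P a = ((stdPart a : ℝ) : OnePoint ℝ) := by
  rw [placeOf, if_pos]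
  · congr 1
    refine IsGLB.csInf_eq ⟨?_, ?_⟩ ?_
    · rintro _ ⟨r, hr, rfl⟩
      rw [hP, sub_nonneg] at hr
      simpa using stdPart_monotoneOn ha (mk_ratCast_nonneg r) hr
    · intro y hy
      refine le_of_forall_gt fun c hc => ?_
      obtain ⟨r, hr1, hr2⟩ := exists_rat_btwn hc
      refine (hy ⟨r, ?_, rfl⟩).trans_lt hr2
      rw [hP, sub_nonneg]
      exact (lt_ratCast_of_stdPart_lt ha hr1).le
    · obtain ⟨r, _, hr⟩ := mk_nonneg_iff_exists_rat.1 ha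
      exact ⟨r, r, by rwa [hP, sub_nonneg], rfl⟩
  · obtain ⟨r, h1, h2⟩ := mk_nonneg_iff_exists_rat.1 ha
    exact ⟨r, by rwa [hP, sub_nonneg], by rwa [hP, sub_nonneg]⟩

theorem placeOf_eq_infty {P : RingPreordering K} (hP : ∀ x : K, x ∈ P ↔ 0 ≤ x) {a : K}
    (ha : ¬ 0 ≤ mk a) : placeOf P a = OnePoint.infty := by
  rw [placeOf, if_neg]
  rintro ⟨r, h1, h2⟩
  rw [hP, sub_nonneg] at h1 h2
  exact ha (mk_nonneg_iff_exists_rat.2 ⟨r, h1, h2⟩)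

/-- Elements of the real holomorphy ring are finite in every ordering, because the finite elements
form a valuation ring whose residue field is ordered. -/
theorem mk_nonneg_of_mem_holomorphyRing {a : K} (ha : a ∈ holomorphyRing K) : 0 ≤ mk a :=
  mem_holomorphyRing.1 ha (addValuation K).toValuation.valuationSubring
    (inferInstanceAs (IsFormallyReal (FiniteResidueField K)))

end LinearOrder

/-- The value in `ℝ` of an element of the real holomorphy ring at a place. The value `0` assigned to
`∞` plays no role, as the place is finite on this ring: see `coe_evalHom`. -/
noncomputable def evalHom (l : placeSpace K) : holomorphyRing K →+* ℝ where
  toFun h := (l.1 (h : K)).elim 0 id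
  map_one' := by
    obtain ⟨_, P, hP, rfl⟩ := l
    obtain ⟨_, _, h⟩ := exists_linearOrder P hP
    simp [placeOf_eq_stdPart h (mk_nonneg_of_mem_holomorphyRing (one_mem _))]
  map_zero' := by
    obtain ⟨_, P, hP, rfl⟩ := l
    obtain ⟨_, _, h⟩ := exists_linearOrder P hP
    simp [placeOf_eq_stdPart h (mk_nonneg_of_mem_holomorphyRing (zero_mem _))]
  map_mul' a b := by
    obtain ⟨_, P, hP, rfl⟩ := l
    obtain ⟨_, _, h⟩ := exists_linearOrder P hP
    simp only [placeOf_eq_stdPart h (mk_nonneg_of_mem_holomorphyRing (Subtype.prop _)),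
      OnePoint.elim_some, id]
    exact stdPart_mul (mk_nonneg_of_mem_holomorphyRing a.2) (mk_nonneg_of_mem_holomorphyRing b.2)
  map_add' a b := by
    obtain ⟨_, P, hP, rfl⟩ := l
    obtain ⟨_, _, h⟩ := exists_linearOrder P hP
    simp only [placeOf_eq_stdPart h (mk_nonneg_of_mem_holomorphyRing (Subtype.prop _)),
      OnePoint.elim_some, id]
    exact stdPart_add (mk_nonneg_of_mem_holomorphyRing a.2) (mk_nonneg_of_mem_holomorphyRing b.2)

theorem coe_evalHom (l : placeSpace K) (h : holomorphyRing K) :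
    ((evalHom l h : ℝ) : OnePoint ℝ) = l.1 h := by
  change (((l.1 (h : K)).elim 0 id : ℝ) : OnePoint ℝ) = l.1 h
  obtain ⟨_, P, hP, rfl⟩ := l
  obtain ⟨_, _, hP'⟩ := exists_linearOrder P hP
  simp [placeOf_eq_stdPart hP' (mk_nonneg_of_mem_holomorphyRing h.2)]

theorem evalHom_mk_eq_stdPart [LinearOrder K] [IsStrictOrderedRing K] {P : RingPreordering K}
    (hP : ∀ x : K, x ∈ P ↔ 0 ≤ x) (hl : placeOf P ∈ placeSpace K) (h : holomorphyRing K) :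
    evalHom ⟨placeOf P, hl⟩ h = stdPart (h : K) := by
  apply OnePoint.coe_injective
  exact (coe_evalHom _ h).trans (placeOf_eq_stdPart hP (mk_nonneg_of_mem_holomorphyRing h.2))

theorem mem_of_evalHom_pos {P : RingPreordering K} (hP : P.IsOrdering) {h : holomorphyRing K}
    (hh : 0 < evalHom ⟨placeOf P, placeOf_mem_placeSpace hP⟩ h) : (h : K) ∈ P := by
  obtain ⟨_, _, hP'⟩ := exists_linearOrder P hP
  rw [evalHom_mk_eq_stdPart hP'] at hh
  rw [hP']
  have := le_of_ratCast_lt_stdPart (mk_nonneg_of_mem_holomorphyRing h.2) (r := 0)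
    (by simpa using hh)
  exact le_of_lt (by simpa using this)

/-- An element of the real holomorphy ring that is positive at all places is a sum of squares. -/
theorem mem_sumPow_two_of_forall_evalHom_pos [IsFormallyReal K] {h : holomorphyRing K}
    (hh : ∀ l, 0 < evalHom l h) : (h : K) ∈ sumPow K 2 :=
  mem_sumPow_two_iff.2 <| isSumSq_of_forall_mem_isOrdering fun _ hP =>
    mem_of_evalHom_pos hP (hh _)

theorem evalHom_nonneg_of_mem_sumPow_two (l : placeSpace K) {h : holomorphyRing K}
    (hh : (h : K) ∈ sumPow K 2) : 0 ≤ evalHom l h := by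
  obtain ⟨_, P, hP, rfl⟩ := l
  by_contra! hc
  have h1 : ((-h : holomorphyRing K) : K) ∈ P := mem_of_evalHom_pos hP (by simpa using hc)
  have h2 : (h : K) ∈ P := P.mem_of_isSumSq (mem_sumPow_two_iff.1 hh)
  have h3 : (h : K) = 0 := RingPreordering.eq_zero_of_mem_of_neg_mem h2 (by simpa using h1)
  have h4 : h = 0 := Subtype.ext h3
  simp [h4] at hc

theorem evalHom_unit_ne_zero (l : placeSpace K) (e : (holomorphyRing K)ˣ) :
    evalHom l (e : holomorphyRing K) ≠ 0 :=
  (e.isUnit.map (evalHom l)).ne_zero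

theorem mem_posUnits_iff_forall_evalHom_pos [IsFormallyReal K] {e : (holomorphyRing K)ˣ} :
    e ∈ posUnits K ↔ ∀ l, 0 < evalHom l (e : holomorphyRing K) :=
  ⟨fun h l => (evalHom_nonneg_of_mem_sumPow_two l h).lt_of_ne (evalHom_unit_ne_zero l e).symm,
    fun h => mem_sumPow_two_of_forall_evalHom_pos h⟩

end

/-! ### Valuation rings with formally real residue field -/

section

open ArchimedeanClass

section Valuation

variable (A : ValuationSubring K) [IsFormallyReal (IsLocalRing.ResidueField A)]

/-- The elements of the form `y² w`, where `w` is a unit of the valuation ring `A` whose residue is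
a sum of squares, form a preordering when the residue field is formally real. -/
def residuePreordering : RingPreordering K :=
  RingPreordering.mk'
    {z | ∃ (y : K) (w : A), IsSumSq (IsLocalRing.residue A w) ∧ IsLocalRing.residue A w ≠ 0 ∧
      z = y * y * w}
    (by
      -- If `y₁` has the larger value, then `y₁² w₁ + y₂² w₂ = y₁² (w₁ + (y₂ / y₁)² w₂)`.
      have key : ∀ (y₁ : K) (w₁ : A) (y₂ : K) (w₂ : A), IsSumSq (IsLocalRing.residue A w₁) →
          IsLocalRing.residue A w₁ ≠ 0 → IsSumSq (IsLocalRing.residue A w₂) → y₁ ≠ 0 →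
          y₂ / y₁ ∈ A → ∃ (y : K) (w : A), IsSumSq (IsLocalRing.residue A w) ∧
            IsLocalRing.residue A w ≠ 0 ∧ y₁ * y₁ * w₁ + y₂ * y₂ * w₂ = y * y * w := by
        intro y₁ w₁ y₂ w₂ h₁ h₁' h₂ hy hA
        have h3 : IsSumSq (IsLocalRing.residue A ⟨y₂ / y₁, hA⟩ *
            IsLocalRing.residue A ⟨y₂ / y₁, hA⟩ * IsLocalRing.residue A w₂) :=
          (IsSumSq.mul_self _).mul h₂
        refine ⟨y₁, w₁ + ⟨y₂ / y₁, hA⟩ * ⟨y₂ / y₁, hA⟩ * w₂, ?_, ?_, ?_⟩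
        · simpa only [map_add, map_mul] using h₁.add h3
        · simp only [map_add, map_mul]
          exact fun h => h₁' (IsFormallyReal.eq_zero_of_add_right h₁ h3 h)
        · push_cast
          field_simp
      rintro _ _ ⟨y₁, w₁, h₁, h₁', rfl⟩ ⟨y₂, w₂, h₂, h₂', rfl⟩
      by_cases hy₁ : y₁ = 0
      · exact ⟨y₂, w₂, h₂, h₂', by simp [hy₁]⟩
      by_cases hy₂ : y₂ = 0
      · exact ⟨y₁, w₁, h₁, h₁', by simp [hy₂]⟩
      rcases A.mem_or_inv_mem (y₂ / y₁) with h | h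
      · exact key y₁ w₁ y₂ w₂ h₁ h₁' h₂ hy₁ h
      · rw [add_comm]
        exact key y₂ w₂ y₁ w₁ h₂ h₂' h₁ hy₂ (by simpa using h))
    (by
      rintro _ _ ⟨y₁, w₁, h₁, h₁', rfl⟩ ⟨y₂, w₂, h₂, h₂', rfl⟩
      refine ⟨y₁ * y₂, w₁ * w₂, ?_, ?_, ?_⟩
      · simpa only [map_mul] using h₁.mul h₂
      · simpa only [map_mul] using mul_ne_zero h₁' h₂'
      · push_cast
        ring)
    (fun x => ⟨x, 1, by simp, by simp, by simp⟩)
    (by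
      rintro ⟨y, w, h, h', hw⟩
      have hwu : IsUnit w := by
        simpa using h'
      obtain ⟨u, rfl⟩ := hwu
      -- `(y u)² = -u`, so that `y u` and with it `y` lie in `A`.
      have hu0 : ((u : A) : K) ≠ 0 := fun h0 => u.ne_zero (Subtype.ext h0)
      have hyA : y ∈ A := by
        rw [← A.valuation_le_one_iff]
        have hu1 : A.valuation ((u : A) : K) = 1 := (A.valuation_eq_one_iff (u : A)).1 u.isUnit
        have h1 := congrArg A.valuation hw
        rw [Valuation.map_neg, map_one, map_mul, map_mul, hu1, mul_one] at h1
        by_contra! hc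
        exact absurd h1 (one_lt_mul_of_lt_of_le' hc hc.le).ne
      have h2 : (-1 : A) = ⟨y, hyA⟩ * ⟨y, hyA⟩ * u := Subtype.ext hw
      have h3 := congrArg (IsLocalRing.residue A) h2
      rw [map_mul, map_mul, map_neg, map_one] at h3
      exact one_ne_zero (IsFormallyReal.eq_zero_of_isSumSq_of_neg_isSumSq IsSumSq.one
        (h3 ▸ (IsSumSq.mul_self _).mul h)))

/-- A valuation ring with formally real residue field is compatible with some ordering: the
principal units are positive. -/
theorem exists_isOrdering_one_add_mem :
    ∃ P : RingPreordering K, P.IsOrdering ∧ ∀ x : K, A.valuation x < 1 → 1 + x ∈ P := by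
  obtain ⟨P, hP, hle⟩ := exists_isOrdering_ge (residuePreordering A)
  refine ⟨P, hP, fun x hx => hle ?_⟩
  have hxA : x ∈ A := (A.valuation_le_one_iff x).1 hx.le
  have hres : IsLocalRing.residue A ⟨x, hxA⟩ = 0 := by
    rw [IsLocalRing.residue_eq_zero_iff]
    exact (A.valuation_lt_one_iff ⟨x, hxA⟩).2 hx
  have h1 : IsLocalRing.residue A (1 + ⟨x, hxA⟩) = 1 := by
    rw [map_add, map_one, hres, add_zero]
  exact ⟨1, 1 + ⟨x, hxA⟩, by rw [h1]; exact IsSumSq.one, by rw [h1]; exact one_ne_zero, by simp⟩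

/-- No cancellation of leading terms can occur in a sum of squares. -/
theorem valuation_add_of_mem_sumPow_two {s t : K} (hs : s ∈ sumPow K 2) (ht : t ∈ sumPow K 2) :
    A.valuation (s + t) = max (A.valuation s) (A.valuation t) := by
  have key : ∀ {s t : K}, s ∈ sumPow K 2 → t ∈ sumPow K 2 → A.valuation t ≤ A.valuation s →
      A.valuation (s + t) = A.valuation s := by
    intro s t hs ht hle
    refine le_antisymm ((A.valuation.map_add s t).trans (max_le le_rfl hle)) ?_
    by_contra! hlt
    obtain ⟨P, hP, h⟩ := exists_isOrdering_one_add_mem A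
    have hs0 : s ≠ 0 := by
      rintro rfl
      simp at hlt
    have hv : A.valuation ((s + t) / s) < 1 := by
      rw [map_div₀]
      exact (div_lt_one₀ (by simpa [zero_lt_iff] using hs0)).2 hlt
    have hz : t / s ∈ P := by
      rw [div_eq_mul_inv]
      exact mul_mem (P.mem_of_isSumSq (mem_sumPow_two_iff.1 ht))
        (RingPreordering.inv_mem (P.mem_of_isSumSq (mem_sumPow_two_iff.1 hs)))
    -- With `z = t / s ≥ 0`, both `1 + z` and `-2 (1 + z)` lie in the maximal ideal of `A`,
    -- so that `1 - 2 (1 + z) = -1 - 2 z` is positive.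
    have h2 : 1 + (-((s + t) / s) + -((s + t) / s)) ∈ P := by
      apply h
      refine (A.valuation.map_add _ _).trans_lt (max_lt ?_ ?_) <;> rwa [Valuation.map_neg]
    refine P.neg_one_notMem ?_
    have : (-1 : K) = (1 + (-((s + t) / s) + -((s + t) / s))) + t / s + t / s := by
      field_simp
      ring
    rw [this]
    exact add_mem (add_mem h2 hz) hz
  rcases le_total (A.valuation t) (A.valuation s) with h | h
  · rw [key hs ht h, max_eq_left h]
  · rw [add_comm, key ht hs h, max_eq_right h]

theorem valuation_one_add_sq (a : K) :
    A.valuation (1 + a ^ 2) = max 1 (A.valuation a ^ 2) := by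
  rw [valuation_add_of_mem_sumPow_two A (one_mem_sumPow 2) (pow_mem_sumPow 2 a), map_one, map_pow]

end Valuation

theorem inv_one_add_sq_mem_holomorphyRing (a : K) : (1 + a ^ 2)⁻¹ ∈ holomorphyRing K := by
  refine mem_holomorphyRing.2 fun A hA => ?_
  rw [← A.valuation_le_one_iff, map_inv₀, valuation_one_add_sq]
  exact inv_le_one_of_one_le₀ (le_max_left _ _)

theorem mul_inv_one_add_sq_mem_holomorphyRing (a : K) :
    a * (1 + a ^ 2)⁻¹ ∈ holomorphyRing K := by
  refine mem_holomorphyRing.2 fun A hA => ?_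
  rw [← A.valuation_le_one_iff, map_mul, map_inv₀, valuation_one_add_sq]
  refine mul_inv_le_one_of_le₀ ?_ zero_le
  rcases le_total (A.valuation a) 1 with h | h
  · exact h.trans (le_max_left _ _)
  · exact (le_self_pow₀ h two_ne_zero).trans (le_max_right _ _)

/-- An element of the real holomorphy ring that vanishes at no place is a unit: if it were not
invertible in a valuation ring `A` with formally real residue field, it would be infinitesimal for
every ordering compatible with `A`. -/
theorem isUnit_of_forall_evalHom_ne_zero [IsFormallyReal K] {h : holomorphyRing K}
    (hh : ∀ l, evalHom l h ≠ 0) : IsUnit h := by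
  have h0 : (h : K) ≠ 0 := by
    intro h0
    obtain ⟨P, hP⟩ := exists_isOrdering K
    have : h = 0 := Subtype.ext h0
    exact hh ⟨placeOf P, placeOf_mem_placeSpace hP⟩ (by simp [this])
  suffices hinv : (h : K)⁻¹ ∈ holomorphyRing K from
    IsUnit.of_mul_eq_one ⟨(h : K)⁻¹, hinv⟩ (Subtype.ext (mul_inv_cancel₀ h0))
  refine mem_holomorphyRing.2 fun A hA => ?_
  by_contra hc
  have hv : A.valuation (h : K) < 1 := by
    rw [← A.valuation_le_one_iff, map_inv₀, not_le] at hc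
    exact (one_lt_inv₀ (by simpa [zero_lt_iff] using h0)).1 hc
  obtain ⟨P, hP, hPA⟩ := exists_isOrdering_one_add_mem A
  refine hh ⟨placeOf P, placeOf_mem_placeSpace hP⟩ ?_
  obtain ⟨_, _, hP'⟩ := exists_linearOrder P hP
  rw [evalHom_mk_eq_stdPart hP', stdPart_eq_zero]
  have hnat : ∀ n : ℕ, A.valuation (n : K) ≤ 1 := fun n =>
    (A.valuation_le_one_iff _).2 (natCast_mem A n)
  refine (?_ : (0 : ArchimedeanClass K) < mk (h : K)).ne'
  rw [← mk_one (R := K), mk_lt_mk]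
  intro n
  -- `2 n h` is infinitesimal, so `|2 n h| ≤ 1`, which gives the strict inequality `n |h| < 1`.
  have hlt : A.valuation (((2 * n : ℕ) : K) * h) < 1 := by
    rw [map_mul]
    exact (mul_le_of_le_one_left' (hnat _)).trans_lt hv
  have h1 := (hP' _).1 (hPA _ hlt)
  have h2 := (hP' _).1 (hPA (-(((2 * n : ℕ) : K) * h)) (by rwa [Valuation.map_neg]))
  push_cast at h1 h2
  rw [nsmul_eq_mul, abs_one, ← Nat.abs_cast n, ← abs_mul, abs_lt]
  constructor <;> linarith

end

/-! ### Compactness of the space of real places -/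

section

open Filter Topology ArchimedeanClass

/-- The limit of a family of preorderings along an ultrafilter `F`: an element is nonnegative if it
is so for `F`-almost all members of the family. -/
def ultraPreordering {ι : Type*} (F : Ultrafilter ι) (P : ι → RingPreordering K) :
    RingPreordering K :=
  RingPreordering.mk' {x | ∀ᶠ i in F, x ∈ P i}
    (fun hx hy => by filter_upwards [hx, hy] with i using add_mem)
    (fun hx hy => by filter_upwards [hx, hy] with i using mul_mem)
    (fun x => Eventually.of_forall fun i => (P i).mul_self_mem x)
    (fun h => by
      obtain ⟨i, hi⟩ := h.exists
      exact (P i).neg_one_notMem hi)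

theorem isOrdering_ultraPreordering {ι : Type*} (F : Ultrafilter ι) (P : ι → RingPreordering K)
    (hP : ∀ i, (P i).IsOrdering) : (ultraPreordering F P).IsOrdering := by
  refine RingPreordering.isOrdering_iff.2 fun a b hab => ?_
  change (∀ᶠ i in F, a ∈ P i) ∨ ∀ᶠ i in F, b ∈ P i
  rw [← Ultrafilter.eventually_or]
  have hab' : ∀ᶠ i in F, -(a * b) ∈ P i := hab
  filter_upwards [hab'] with i hi
  exact RingPreordering.isOrdering_iff.1 (hP i) a b hi

/-- The place of an ordering depends continuously on the ordering. -/
theorem tendsto_placeOf_ultraPreordering {ι : Type*} (F : Ultrafilter ι)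
    (P : ι → RingPreordering K) (hP : ∀ i, (P i).IsOrdering) (a : K) :
    Tendsto (fun i => placeOf (P i) a) F (𝓝 (placeOf (ultraPreordering F P) a)) := by
  have hQ := isOrdering_ultraPreordering F P hP
  set Q := ultraPreordering F P with hQdef
  obtain ⟨_, _, hQ'⟩ := exists_linearOrder Q hQ
  have hmem : ∀ x : K, x ∈ Q ↔ ∀ᶠ i in F, x ∈ P i := fun x => Iff.rfl
  by_cases ha : 0 ≤ mk a
  · rw [placeOf_eq_stdPart hQ' ha]
    rw [OnePoint.nhds_coe_eq]
    have hbdd : ∀ r s : ℚ, (r : ℝ) < stdPart a → stdPart a < (s : ℝ) →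
        ∀ᶠ i in F, ∃ y : ℝ, (r : ℝ) ≤ y ∧ y ≤ s ∧ placeOf (P i) a = (y : OnePoint ℝ) := by
      intro r s hr hs
      have h1 := (hmem _).1 ((hQ' (a - r)).2 (sub_nonneg.2 (le_of_ratCast_lt_stdPart ha hr).le))
      have h2 := (hmem _).1 ((hQ' (s - a)).2 (sub_nonneg.2 (lt_ratCast_of_stdPart_lt ha hs).le))
      filter_upwards [h1, h2] with i hi1 hi2
      -- From here on `≤` and `stdPart` refer to the ordering `P i` instead of the limit.
      obtain ⟨L, _, hi⟩ := exists_linearOrder (P i) (hP i)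
      rw [hi, sub_nonneg] at hi1 hi2
      have hfin : 0 ≤ mk a :=
        mk_nonneg_iff_exists_rat.2 ⟨max |r| |s|, by
          have : -((max |r| |s| : ℚ) : K) ≤ r := by
            rw [← Rat.cast_neg, Rat.cast_le]
            linarith [neg_abs_le r, le_max_left |r| |s|]
          exact this.trans hi1, hi2.trans (by
            rw [Rat.cast_le]
            exact (le_abs_self s).trans (le_max_right _ _))⟩
      refine ⟨stdPart a, ?_, ?_, placeOf_eq_stdPart hi hfin⟩
      · simpa using stdPart_monotoneOn (mk_ratCast_nonneg r) hfin hi1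
      · simpa using stdPart_monotoneOn hfin (mk_ratCast_nonneg s) hi2
    intro U hU
    rw [mem_map, mem_nhds_iff_exists_Ioo_subset] at hU
    obtain ⟨l, u, ⟨hl, hu⟩, hsub⟩ := hU
    obtain ⟨r, hr1, hr2⟩ := exists_rat_btwn hl
    obtain ⟨s, hs1, hs2⟩ := exists_rat_btwn hu
    change ∀ᶠ i in F, placeOf (P i) a ∈ U
    filter_upwards [hbdd r s hr2 hs1] with i ⟨y, hy1, hy2, hy⟩
    rw [hy]
    exact hsub ⟨hr1.trans_le hy1, hy2.trans_lt hs2⟩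
  · rw [placeOf_eq_infty hQ' ha]
    have hunb : ∀ n : ℕ, ∀ᶠ i in F, ∀ y : ℝ,
        placeOf (P i) a = (y : OnePoint ℝ) → (n : ℝ) ≤ |y| := by
      intro n
      have hn : ∀ᶠ i in F, a - n ∈ P i ∨ -n - a ∈ P i := by
        rw [Ultrafilter.eventually_or, ← hmem, ← hmem, hQ', hQ', sub_nonneg, sub_nonneg]
        by_contra! hc
        exact ha (mk_nonneg_iff_exists_rat.2 ⟨n, by simpa using hc.2.le, by simpa using hc.1.le⟩)
      filter_upwards [hn] with i hi y hy
      -- From here on `≤` and `stdPart` refer to the ordering `P i` instead of the limit.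
      obtain ⟨L, _, hi'⟩ := exists_linearOrder (P i) (hP i)
      by_cases hfin : 0 ≤ mk a
      · rw [placeOf_eq_stdPart hi' hfin] at hy
        have hy' : stdPart a = y := OnePoint.coe_injective hy
        rw [hi', hi', sub_nonneg, sub_nonneg] at hi
        rcases hi with hi | hi
        · have := stdPart_monotoneOn (mk_natCast_nonneg n) hfin hi
          rw [stdPart_natCast, hy'] at this
          exact this.trans (le_abs_self y)
        · have hn' : 0 ≤ mk (-(n : K)) := by simpa using mk_natCast_nonneg (S := K) n
          have := stdPart_monotoneOn hfin hn' hi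
          rw [stdPart_neg, stdPart_natCast, hy'] at this
          linarith [neg_abs_le y]
      · rw [placeOf_eq_infty hi' hfin] at hy
        exact absurd hy (OnePoint.infty_ne_coe y)
    rw [OnePoint.hasBasis_nhds_infty.tendsto_right_iff]
    rintro s ⟨_, hs⟩
    obtain ⟨C, hC⟩ := hs.isBounded.exists_norm_le
    obtain ⟨n, hn⟩ := exists_nat_gt C
    filter_upwards [hunb n] with i hi
    rcases h : placeOf (P i) a with _ | y
    · exact Or.inr rfl
    · refine Or.inl ⟨y, fun hys => ?_, rfl⟩
      have := hi y h
      have := hC y hys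
      rw [Real.norm_eq_abs] at this
      linarith

theorem isCompact_placeSpace (K : Type*) [Field K] : IsCompact (placeSpace K) := by
  rw [isCompact_iff_ultrafilter_le_nhds']
  intro F hF
  choose P hP hlP using fun l : placeSpace K => l.2
  obtain ⟨l₀, P₀, hP₀, -⟩ := F.nonempty_of_mem hF
  -- The ultrafilter lives on all functions `K → ℝ ∪ {∞}`; outside `placeSpace K` the ordering is
  -- irrelevant.
  classical
  let P' : (K → OnePoint ℝ) → RingPreordering K := fun l =>
    if hl : l ∈ placeSpace K then P ⟨l, hl⟩ else P₀
  have hP' : ∀ l, (P' l).IsOrdering := fun l => by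
    by_cases hl : l ∈ placeSpace K
    · simpa only [P', dif_pos hl] using hP ⟨l, hl⟩
    · simpa only [P', dif_neg hl] using hP₀
  refine ⟨placeOf (ultraPreordering F P'),
    placeOf_mem_placeSpace (isOrdering_ultraPreordering F P' hP'), ?_⟩
  have h : Tendsto (fun l => placeOf (P' l)) F (𝓝 (placeOf (ultraPreordering F P'))) :=
    tendsto_pi_nhds.2 fun a => tendsto_placeOf_ultraPreordering F P' hP' a
  have h2 : Tendsto id (F : Filter (K → OnePoint ℝ)) (𝓝 (placeOf (ultraPreordering F P'))) :=
    h.congr' (by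
      filter_upwards [hF] with l hl
      simp only [P', dif_pos hl]
      exact (hlP ⟨l, hl⟩).symm)
  simpa [Tendsto] using h2

instance : CompactSpace (placeSpace K) := isCompact_iff_compactSpace.1 (isCompact_placeSpace K)

theorem continuous_evalHom (h : holomorphyRing K) :
    Continuous fun l : placeSpace K => evalHom l h := by
  rw [(OnePoint.isOpenEmbedding_coe (X := ℝ)).isInducing.continuous_iff]
  have : (fun x : ℝ => (x : OnePoint ℝ)) ∘ (fun l : placeSpace K => evalHom l h) =
      fun l => l.1 (h : K) := funext fun l => coe_evalHom l h
  rw [this]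
  exact (continuous_apply _).comp continuous_subtype_val

/-- Places agreeing on the real holomorphy ring are equal: `a` is the quotient of the elements
`a / (1 + a²)` and `1 / (1 + a²)` of that ring, and is infinite exactly where the latter is zero. -/
theorem evalHom_injective : Function.Injective (evalHom : placeSpace K → _) := by
  have key : ∀ (l : placeSpace K) (a : K), l.1 a =
      if evalHom l ⟨_, inv_one_add_sq_mem_holomorphyRing a⟩ = 0 then OnePoint.infty else
        ((evalHom l ⟨_, mul_inv_one_add_sq_mem_holomorphyRing a⟩ /
          evalHom l ⟨_, inv_one_add_sq_mem_holomorphyRing a⟩ : ℝ) : OnePoint ℝ) := by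
    intro l a
    obtain ⟨P, hP, hl⟩ := l.2
    obtain rfl : l = ⟨placeOf P, placeOf_mem_placeSpace hP⟩ := Subtype.ext hl
    obtain ⟨_, _, hP'⟩ := exists_linearOrder P hP
    rw [evalHom_mk_eq_stdPart hP', evalHom_mk_eq_stdPart hP']
    change placeOf P a = if stdPart (1 + a ^ 2)⁻¹ = 0 then _ else
      ((stdPart (a * (1 + a ^ 2)⁻¹) / stdPart (1 + a ^ 2)⁻¹ : ℝ) : OnePoint ℝ)
    by_cases ha : 0 ≤ mk a
    · have ha2 : 0 ≤ ArchimedeanClass.mk (a ^ 2) := by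
        rw [pow_two, mk_mul]
        exact add_nonneg ha ha
      have h1 : stdPart (1 + a ^ 2) = 1 + stdPart a ^ 2 := by
        rw [stdPart_add (mk_one (R := K)).ge ha2, stdPart_one, pow_two, pow_two, stdPart_mul ha ha]
      have h2 : (1 + stdPart a ^ 2 : ℝ) ≠ 0 := by positivity
      have h3 : stdPart (1 + a ^ 2)⁻¹ ≠ 0 := by
        rw [stdPart_inv, h1]
        exact inv_ne_zero h2
      rw [if_neg h3, placeOf_eq_stdPart hP' ha,
        stdPart_mul ha (not_not.1 (mt stdPart_eq_zero.2 h3)).ge, mul_div_cancel_right₀ _ h3]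
    · rw [placeOf_eq_infty hP' ha, if_pos]
      rw [stdPart_inv, inv_eq_zero, stdPart_eq_zero]
      intro h
      obtain ⟨r, h1, h2⟩ := mk_nonneg_iff_exists_rat.1 h.ge
      refine ha (mk_nonneg_iff_exists_rat.2 ⟨r, ?_, ?_⟩) <;>
        nlinarith [sq_nonneg (a - 1), sq_nonneg (a + 1)]
  intro l l' h
  refine Subtype.ext (funext fun a => ?_)
  rw [key l, key l', h]

end

/-! ### Units of the holomorphy ring and clopen sets of places -/

section

open Filter Topology

/-- The elements of the real holomorphy ring as continuous functions on the space of places. -/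
noncomputable def toContinuousMap (K : Type*) [Field K] :
    holomorphyRing K →+* C(placeSpace K, ℝ) where
  toFun h := ⟨fun l => evalHom l h, continuous_evalHom h⟩
  map_one' := ContinuousMap.ext fun l => map_one (evalHom l)
  map_zero' := ContinuousMap.ext fun l => map_zero (evalHom l)
  map_mul' a b := ContinuousMap.ext fun l => map_mul (evalHom l) a b
  map_add' a b := ContinuousMap.ext fun l => map_add (evalHom l) a b

theorem inv_natCast_succ_mem_holomorphyRing (n : ℕ) :
    ((n + 1 : ℕ) : K)⁻¹ ∈ holomorphyRing K := by
  refine mem_holomorphyRing.2 fun A hA => ?_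
  have h : IsUnit ((n + 1 : ℕ) : A) := by
    by_contra hc
    have h0 : IsLocalRing.residue A ((n + 1 : ℕ) : A) = 0 :=
      (IsLocalRing.residue_eq_zero_iff _).2 ((IsLocalRing.mem_maximalIdeal _).2 hc)
    rw [map_natCast, Nat.cast_succ, add_comm] at h0
    exact one_ne_zero (IsFormallyReal.eq_zero_of_add_right IsSumSq.one (IsSumSq.natCast n) h0)
  have := (A.valuation_eq_one_iff _).1 h
  rw [← A.valuation_le_one_iff, map_inv₀]
  push_cast at this ⊢
  rw [this, inv_one]

theorem ratCast_mem_range_toContinuousMap [CharZero K] (q : ℚ) :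
    algebraMap ℝ C(placeSpace K, ℝ) q ∈ (toContinuousMap K).range := by
  obtain ⟨n, hn⟩ := Nat.exists_eq_succ_of_ne_zero q.den_nz
  let i : holomorphyRing K := ⟨_, inv_natCast_succ_mem_holomorphyRing n⟩
  have hi : ((q.den : ℕ) : holomorphyRing K) * i = 1 := by
    refine Subtype.ext ?_
    rw [hn]
    exact mul_inv_cancel₀ (Nat.cast_ne_zero.2 (Nat.succ_ne_zero n))
  refine ⟨(q.num : holomorphyRing K) * i, ContinuousMap.ext fun l => ?_⟩
  have h1 := congrArg (evalHom l) hi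
  rw [map_mul, map_natCast, map_one] at h1
  change evalHom l ((q.num : holomorphyRing K) * i) = (q : ℝ)
  rw [map_mul, map_intCast, Rat.cast_def, div_eq_mul_inv, eq_inv_of_mul_eq_one_right h1]

/-- The closure of the image of the real holomorphy ring in the ring of continuous functions. It is
stable under real scalars because the rational constants lie in the image. -/
noncomputable def closureSubalgebra (K : Type*) [Field K] [CharZero K] :
    Subalgebra ℝ C(placeSpace K, ℝ) where
  __ := (toContinuousMap K).range.topologicalClosure.toSubsemiring
  algebraMap_mem' r := by
    have hc : Continuous (algebraMap ℝ C(placeSpace K, ℝ)) := continuous_algebraMap ℝ _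
    have h : r ∈ closure (Set.range ((↑) : ℚ → ℝ)) := Rat.denseRange_cast r
    refine map_mem_closure hc h ?_
    rintro _ ⟨q, rfl⟩
    exact ratCast_mem_range_toContinuousMap q

/-- The image of the real holomorphy ring is dense in the continuous real functions on the space of
places, by the theorem of Stone and Weierstrass. -/
theorem exists_evalHom_near [CharZero K] {f : placeSpace K → ℝ} (hf : Continuous f) {ε : ℝ}
    (hε : 0 < ε) : ∃ h : holomorphyRing K, ∀ l, |evalHom l h - f l| < ε := by
  have hsep : (closureSubalgebra K).SeparatesPoints := by
    intro l l' hne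
    have : evalHom l ≠ evalHom l' := fun h => hne (evalHom_injective h)
    obtain ⟨h, hh⟩ := DFunLike.ne_iff.1 this
    exact ⟨toContinuousMap K h, ⟨toContinuousMap K h,
      Subring.le_topologicalClosure _ ⟨h, rfl⟩, rfl⟩, hh⟩
  obtain ⟨⟨g, hg⟩, hgf⟩ :=
    ContinuousMap.exists_mem_subalgebra_near_continuous_of_separatesPoints
      (closureSubalgebra K) hsep f hf (ε / 2) (half_pos hε)
  have hg' : g ∈ closure ((toContinuousMap K).range : Set C(placeSpace K, ℝ)) := hg
  obtain ⟨_, ⟨h, rfl⟩, hh⟩ := Metric.mem_closure_iff.1 hg' (ε / 2) (half_pos hε)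
  refine ⟨h, fun l => ?_⟩
  have h1 : |g l - f l| < ε / 2 := hgf l
  have h2 : |g l - evalHom l h| < ε / 2 := (ContinuousMap.dist_apply_le_dist l).trans_lt hh
  rw [abs_lt] at h1 h2 ⊢
  constructor <;> linarith

/-- The set of places at which a unit of the real holomorphy ring is positive. -/
noncomputable def posClopen (e : (holomorphyRing K)ˣ) :
    TopologicalSpace.Clopens (placeSpace K) where
  carrier := {l | 0 < evalHom l (e : holomorphyRing K)}
  isClopen' := by
    have h : {l | 0 < evalHom l (e : holomorphyRing K)} =
        {l | 0 ≤ evalHom l (e : holomorphyRing K)} :=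
      Set.ext fun l => (show _ < _ ↔ _ ≤ _ from
        (evalHom_unit_ne_zero l e).symm.le_iff_lt.symm)
    refine ⟨?_, isOpen_lt continuous_const (continuous_evalHom _)⟩
    rw [h]
    exact isClosed_le continuous_const (continuous_evalHom _)

theorem mem_posClopen {e : (holomorphyRing K)ˣ} {l : placeSpace K} :
    l ∈ posClopen e ↔ 0 < evalHom l (e : holomorphyRing K) :=
  Iff.rfl

theorem posClopen_surjective [IsFormallyReal K] [CharZero K] :
    Function.Surjective (posClopen : (holomorphyRing K)ˣ → _) := by
  classical
  intro C
  let f : placeSpace K → ℝ := fun l => if l ∈ C then 1 else -1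
  have hf : Continuous f := by
    refine continuous_const.if (fun l hl => ?_) continuous_const
    rw [show {l | l ∈ C} = (C : Set (placeSpace K)) from rfl, C.isClopen.frontier_eq] at hl
    exact hl.elim
  obtain ⟨h, hh⟩ := exists_evalHom_near hf one_pos
  have hpos : ∀ l, l ∈ C → 0 < evalHom l h := fun l hl => by
    have := hh l
    simp only [f, if_pos hl, abs_lt] at this
    linarith
  have hneg : ∀ l, l ∉ C → evalHom l h < 0 := fun l hl => by
    have := hh l
    simp only [f, if_neg hl, abs_lt] at this
    linarith
  have hu : IsUnit h := isUnit_of_forall_evalHom_ne_zero fun l => by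
    by_cases hl : l ∈ C
    · exact (hpos l hl).ne'
    · exact (hneg l hl).ne
  obtain ⟨e, rfl⟩ := hu
  refine ⟨e, TopologicalSpace.Clopens.ext (Set.ext fun l => ⟨fun hl => ?_, fun hl => hpos l hl⟩)⟩
  by_contra hc
  exact (hneg l hc).not_gt hl

theorem posClopen_eq_iff [IsFormallyReal K] {e e' : (holomorphyRing K)ˣ} :
    posClopen e = posClopen e' ↔ e⁻¹ * e' ∈ posUnits K := by
  rw [mem_posUnits_iff_forall_evalHom_pos, SetLike.ext_iff]
  refine forall_congr' fun l => ?_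
  rw [mem_posClopen, mem_posClopen, Units.val_mul, map_mul]
  have h1 : evalHom l ((e⁻¹ : (holomorphyRing K)ˣ) : holomorphyRing K) *
      evalHom l (e : holomorphyRing K) = 1 := by
    rw [← map_mul, Units.inv_mul, map_one]
  rw [eq_inv_of_mul_eq_one_left h1]
  have h0 := evalHom_unit_ne_zero l e
  have h0' := evalHom_unit_ne_zero l e'
  rcases lt_or_gt_of_ne h0 with h | h <;> rcases lt_or_gt_of_ne h0' with h' | h'
  · simp [h.not_gt, h'.not_gt, mul_pos_of_neg_of_neg (inv_lt_zero.2 h) h']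
  · simp [h.not_gt, h', (mul_neg_of_neg_of_pos (inv_lt_zero.2 h) h').not_gt]
  · simp [h, h'.not_gt, (mul_neg_of_pos_of_neg (inv_pos.2 h) h').not_gt]
  · simp [h, h', mul_pos (inv_pos.2 h) h']

/-- Taking the set of places where a unit is positive identifies `E / E⁺` with the clopen subsets
of the space of places. -/
noncomputable def quotientPosUnitsEquiv (K : Type*) [Field K] [IsFormallyReal K] [CharZero K] :
    (holomorphyRing K)ˣ ⧸ posUnits K ≃ TopologicalSpace.Clopens (placeSpace K) :=
  Equiv.ofBijective
    (Quotient.lift posClopen fun _ _ h => posClopen_eq_iff.2 (QuotientGroup.leftRel_apply.1 h)) <|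
  by
    constructor
    · rintro ⟨e⟩ ⟨e'⟩ h
      exact QuotientGroup.eq.2 (posClopen_eq_iff.1 h)
    · intro C
      obtain ⟨e, rfl⟩ := posClopen_surjective C
      exact ⟨QuotientGroup.mk e, rfl⟩

end

/-! ### Squares that are sums of fourth powers -/

theorem sq_mem_sumPow_four_of_mem_sumPow_two [CharZero K] {s : K} (hs : s ∈ sumPow K 2) :
    s ^ 2 ∈ sumPow K 4 := by
  by_cases h : s = 0
  · simp [h]
  · exact (squaresOfSumSq_le K ⟨Units.mk0 s h, hs, rfl⟩).2

theorem inv_mem_sumPow {n : ℕ} [NeZero n] {s : K} (hs : s ∈ sumPow K n) : s⁻¹ ∈ sumPow K n := by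
  by_cases h : s = 0
  · simp [h]
  · exact (unitSumPow K n).inv_mem (x := Units.mk0 s h) hs

/-- If `|x|` is close to `1` at all places, then `x²` is a sum of fourth powers. Indeed
`2 x² (1 + x²)² = p² + q²` with `p, q = x (2 x ± (1 - x²))`, and both `p` and `q` are positive at
all places. -/
theorem sq_mem_sumPow_four_of_near_one [IsFormallyReal K] [CharZero K] {x : holomorphyRing K}
    (hx : ∀ l, 1 / 2 ≤ |evalHom l x| ∧ |evalHom l x| ≤ 3 / 2) : (x : K) ^ 2 ∈ sumPow K 4 := by
  have real : ∀ t : ℝ, 1 / 2 ≤ |t| → |t| ≤ 3 / 2 →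
      0 < t * (t + t + (1 - t ^ 2)) ∧ 0 < t * (t + t - (1 - t ^ 2)) := by
    intro t h1 h2
    rcases abs_cases t with ⟨h, h0⟩ | ⟨h, h0⟩ <;> rw [h] at h1 h2
    · constructor <;> apply mul_pos <;> nlinarith
    · constructor <;> apply mul_pos_of_neg_of_neg <;> nlinarith
  have hp : ((x * (x + x + (1 - x ^ 2)) : holomorphyRing K) : K) ∈ sumPow K 2 :=
    mem_sumPow_two_of_forall_evalHom_pos fun l => by
      simpa using (real _ (hx l).1 (hx l).2).1
  have hq : ((x * (x + x - (1 - x ^ 2)) : holomorphyRing K) : K) ∈ sumPow K 2 :=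
    mem_sumPow_two_of_forall_evalHom_pos fun l => by
      simpa using (real _ (hx l).1 (hx l).2).2
  have hc : (1 + (x : K) ^ 2) ∈ sumPow K 2 := add_mem (one_mem_sumPow 2) (pow_mem_sumPow 2 _)
  have hc0 : (1 + (x : K) ^ 2) ≠ 0 := fun h => one_ne_zero <|
    IsFormallyReal.eq_zero_of_add_right IsSumSq.one
      (by rw [pow_two]; exact IsSumSq.mul_self (x : K)) h
  have h2 : (2 : K) ∈ sumPow K 4 := by
    rw [← one_add_one_eq_two]
    exact add_mem (one_mem_sumPow 4) (one_mem_sumPow 4)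
  have := mul_mem_sumPow 4
    (add_mem (sq_mem_sumPow_four_of_mem_sumPow_two hp) (sq_mem_sumPow_four_of_mem_sumPow_two hq))
    (inv_mem_sumPow (mul_mem_sumPow 4 h2 (sq_mem_sumPow_four_of_mem_sumPow_two hc)))
  convert this using 1
  push_cast
  field_simp
  ring

/-- The square of a unit of the real holomorphy ring is a sum of fourth powers. A positive element
`h` approximating `1 / |e|` reduces this to the unit `h e`, whose absolute value is close to `1`. -/
theorem unit_sq_mem_sumPow_four [IsFormallyReal K] [CharZero K] (e : (holomorphyRing K)ˣ) :
    ((e : holomorphyRing K) : K) ^ 2 ∈ sumPow K 4 := by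
  have hcont : Continuous fun l : placeSpace K => |evalHom l (e : holomorphyRing K)| :=
    (continuous_evalHom _).abs
  have hpos : ∀ l : placeSpace K, 0 < |evalHom l (e : holomorphyRing K)| := fun l =>
    abs_pos.2 (evalHom_unit_ne_zero l e)
  obtain ⟨B, hB⟩ := (isCompact_range hcont).bddAbove
  have hB' : ∀ l : placeSpace K, |evalHom l (e : holomorphyRing K)| ≤ max B 1 := fun l =>
    (hB ⟨l, rfl⟩).trans (le_max_left _ _)
  have hB0 : 0 < max B 1 := lt_max_of_lt_right one_pos
  obtain ⟨h, hh⟩ := exists_evalHom_near (hcont.inv₀ fun l => (hpos l).ne')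
    (ε := 1 / (2 * max B 1)) (by positivity)
  have key : ∀ l, |evalHom l h * |evalHom l (e : holomorphyRing K)| - 1| ≤ 1 / 2 := by
    intro l
    have h1 : evalHom l h * |evalHom l (e : holomorphyRing K)| - 1 =
        (evalHom l h - |evalHom l (e : holomorphyRing K)|⁻¹) *
          |evalHom l (e : holomorphyRing K)| := by
      rw [sub_mul, inv_mul_cancel₀ (hpos l).ne']
    rw [h1, abs_mul, abs_abs]
    calc _ ≤ 1 / (2 * max B 1) * max B 1 :=
          mul_le_mul (hh l).le (hB' l) (hpos l).le (by positivity)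
      _ = 1 / 2 := by field_simp
  have hpos' : ∀ l, 0 < evalHom l h := fun l => by
    have := (abs_le.1 (key l)).1
    exact pos_of_mul_pos_left (by linarith : 0 < evalHom l h * |evalHom l (e : holomorphyRing K)|)
      (hpos l).le
  have hx : ((h * e : holomorphyRing K) : K) ^ 2 ∈ sumPow K 4 := by
    refine sq_mem_sumPow_four_of_near_one fun l => ?_
    rw [map_mul, abs_mul, abs_of_pos (hpos' l)]
    have := abs_le.1 (key l)
    constructor <;> linarith
  have hh2 := sq_mem_sumPow_four_of_mem_sumPow_two (mem_sumPow_two_of_forall_evalHom_pos hpos')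
  have hu : IsUnit h := isUnit_of_forall_evalHom_ne_zero fun l => (hpos' l).ne'
  have hh0 : (h : K) ≠ 0 := fun h0 => hu.ne_zero (Subtype.ext h0)
  convert mul_mem_sumPow 4 hx (inv_mem_sumPow hh2) using 1
  push_cast
  field_simp

/-- A sum `∑ xᵢ⁴` has the same value as `(∑ xᵢ²)²` in all valuation rings with formally real
residue field. -/
theorem exists_mem_sumPow_two_valuation_eq [IsFormallyReal K] {t : K} (ht : t ∈ sumPow K 4) :
    t ∈ sumPow K 2 ∧ ∃ s ∈ sumPow K 2, (s = 0 → t = 0) ∧ ∀ A : ValuationSubring K,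
      IsFormallyReal (IsLocalRing.ResidueField A) → A.valuation s ^ 2 = A.valuation t := by
  induction ht using AddSubmonoid.closure_induction_right with
  | zero => exact ⟨zero_mem _, 0, zero_mem _, fun _ => rfl, fun A _ => by simp⟩
  | add_right t _ q hq ih =>
    obtain ⟨x, rfl⟩ := hq
    obtain ⟨ht, s, hs, h0, hst⟩ := ih
    have hx : x ^ 4 ∈ sumPow K 2 := by
      rw [show x ^ 4 = (x ^ 2) ^ 2 by ring]
      exact pow_mem_sumPow 2 _
    refine ⟨add_mem ht hx, s + x ^ 2, add_mem hs (pow_mem_sumPow 2 x), fun h => ?_,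
      fun A hA => ?_⟩
    · have hs' := mem_sumPow_two_iff.1 hs
      have hx' := mem_sumPow_two_iff.1 (pow_mem_sumPow 2 x)
      have hx0 := pow_eq_zero_iff two_ne_zero |>.1 (IsFormallyReal.eq_zero_of_add_left hs' hx' h)
      simp [h0 (IsFormallyReal.eq_zero_of_add_right hs' hx' h), hx0]
    change _ = A.valuation (t + x ^ 4)
    rw [valuation_add_of_mem_sumPow_two A hs (pow_mem_sumPow 2 x),
      valuation_add_of_mem_sumPow_two A ht hx, ← hst A hA, map_pow, map_pow,
      (pow_left_mono 2).map_max, ← pow_mul]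

theorem exists_unit_holomorphyRing {a : K} (ha : ∀ A : ValuationSubring K,
    IsFormallyReal (IsLocalRing.ResidueField A) → A.valuation a = 1) (ha0 : a ≠ 0) :
    ∃ e : (holomorphyRing K)ˣ, ((e : holomorphyRing K) : K) = a := by
  refine ⟨⟨⟨a, ?_⟩, ⟨a⁻¹, ?_⟩, Subtype.ext (mul_inv_cancel₀ ha0),
    Subtype.ext (inv_mul_cancel₀ ha0)⟩, rfl⟩
  · exact mem_holomorphyRing.2 fun A hA => (A.valuation_le_one_iff _).1 (ha A hA).le
  · exact mem_holomorphyRing.2 fun A hA => (A.valuation_le_one_iff _).1 (by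
      rw [map_inv₀, ha A hA, inv_one])

/-- The homomorphism `E → K*² ∩ ∑ K⁴` that sends `e` to `e²`. -/
noncomputable def sqHom (K : Type*) [Field K] [IsFormallyReal K] [CharZero K] :
    (holomorphyRing K)ˣ →* squaresSumFourth K :=
  ((powMonoidHom 2).comp (Units.map (holomorphyRing K).subtype.toMonoidHom)).codRestrict _
    fun e => ⟨⟨_, rfl⟩, unit_sq_mem_sumPow_four e⟩

/-- Squaring induces an isomorphism from `E / (E⁺ ∪ -E⁺)` to `(K*² ∩ ∑ K⁴) / (∑ K*²)²`. -/
theorem nonempty_mulEquiv (K : Type*) [Field K] [IsFormallyReal K] [CharZero K] :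
    Nonempty ((squaresSumFourth K ⧸ (squaresOfSumSq K).subgroupOf (squaresSumFourth K)) ≃*
      (holomorphyRing K)ˣ ⧸ posNegUnits K) := by
  let N := (squaresOfSumSq K).subgroupOf (squaresSumFourth K)
  let φ := (QuotientGroup.mk' N).comp (sqHom K)
  have hker : φ.ker = posNegUnits K := by
    ext e
    let u : Kˣ := Units.map (holomorphyRing K).subtype.toMonoidHom e
    have h1 : e ∈ φ.ker ↔ ∃ s ∈ unitSumPow K 2, s ^ 2 = u ^ 2 := by
      rw [MonoidHom.mem_ker, MonoidHom.comp_apply, QuotientGroup.mk'_apply,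
        QuotientGroup.eq_one_iff]
      exact Iff.rfl
    rw [h1]
    constructor
    · rintro ⟨s, hs, hsu⟩
      have h2 : (s : K) ^ 2 = (u : K) ^ 2 := by exact_mod_cast congrArg Units.val hsu
      rcases sq_eq_sq_iff_eq_or_eq_neg.1 h2 with h | h
      · exact Or.inl (show (u : K) ∈ sumPow K 2 from h ▸ hs)
      · exact Or.inr (show -(u : K) ∈ sumPow K 2 from h ▸ hs)
    · rintro (h | h)
      · exact ⟨u, h, rfl⟩
      · exact ⟨-u, h, neg_sq u⟩
  have hsurj : Function.Surjective φ := by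
    rintro ⟨⟨_, ⟨b, rfl⟩, hb⟩⟩
    -- For `b² = ∑ xᵢ⁴` and `s = ∑ xᵢ²`, the element `b / s` is a unit of the holomorphy ring.
    have hb4 : (b : K) ^ 2 ∈ sumPow K 4 := hb
    obtain ⟨-, s, hs, h0, hv⟩ := exists_mem_sumPow_two_valuation_eq hb4
    have hs0 : s ≠ 0 := fun h => pow_ne_zero 2 b.ne_zero (h0 h)
    obtain ⟨e, he⟩ := exists_unit_holomorphyRing (a := b / s) (fun A hA => by
      have h := hv A hA
      rw [map_pow] at h
      have h3 : A.valuation s = A.valuation b := (pow_left_inj₀ zero_le zero_le two_ne_zero).1 h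
      rw [map_div₀, h3, div_self (by simp)]) (div_ne_zero b.ne_zero hs0)
    refine ⟨e, QuotientGroup.eq.2 ?_⟩
    refine ⟨Units.mk0 s hs0, hs, Units.ext ?_⟩
    change s ^ 2 = (((Units.map (holomorphyRing K).subtype.toMonoidHom e ^ 2)⁻¹ * b ^ 2 : Kˣ) : K)
    rw [Units.val_mul, Units.val_inv_eq_inv_val, Units.val_pow_eq_pow_val, Units.val_pow_eq_pow_val]
    change s ^ 2 = (((e : holomorphyRing K) : K) ^ 2)⁻¹ * (b : K) ^ 2
    rw [he]
    field_simp
  exact ⟨((QuotientGroup.quotientMulEquivOfEq hker.symm).trans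
    (QuotientGroup.quotientKerEquivOfSurjective φ hsurj)).symm⟩

/-! ### Clopen sets, connected components and indices -/

section

open TopologicalSpace

section Topology

variable {X : Type*} [TopologicalSpace X]

theorem isOpen_connectedComponent_of_finite [Finite (ConnectedComponents X)] (x : X) :
    IsOpen (connectedComponent x) := by
  have : connectedComponent x =
      (⋃ c ∈ {c : ConnectedComponents X | c ≠ x}, ConnectedComponents.mk ⁻¹' {c})ᶜ := by
    rw [← connectedComponents_preimage_singleton]
    ext y
    simp only [Set.mem_preimage, Set.mem_singleton_iff, Set.mem_compl_iff, Set.mem_iUnion,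
      Set.mem_ofPred_eq, exists_prop, not_exists, not_and]
    exact ⟨fun h i hi hy => hi (hy ▸ h), fun h => by_contra fun hc => h _ hc rfl⟩
  rw [this, isOpen_compl_iff]
  refine Set.Finite.isClosed_biUnion (Set.toFinite _) fun c _ => ?_
  obtain ⟨y, rfl⟩ := ConnectedComponents.surjective_coe c
  rw [connectedComponents_preimage_singleton]
  exact isClosed_connectedComponent

/-- If there are finitely many connected components, the clopen sets are the unions of
components. -/
theorem nonempty_clopens_equiv_set [Finite (ConnectedComponents X)] :
    Nonempty (Clopens X ≃ Set (ConnectedComponents X)) := by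
  have : DiscreteTopology (ConnectedComponents X) :=
    ConnectedComponents.discreteTopology_iff.2 isOpen_connectedComponent_of_finite
  refine ⟨(Equiv.ofBijective (fun S : Set (ConnectedComponents X) =>
    (⟨ConnectedComponents.mk ⁻¹' S,
      (isClopen_discrete S).preimage ConnectedComponents.continuous_coe⟩ : Clopens X))
    ⟨fun S T h => ?_, fun C => ⟨ConnectedComponents.mk '' C, Clopens.ext ?_⟩⟩).symm⟩
  · exact ConnectedComponents.surjective_coe.preimage_injective (congrArg Clopens.carrier h)
  · change ConnectedComponents.mk ⁻¹' (ConnectedComponents.mk '' (C : Set X)) = C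
    rw [connectedComponents_preimage_image, C.isClopen.biUnion_connectedComponent_eq]

theorem finite_connectedComponents_iff_finite_clopens :
    Finite (ConnectedComponents X) ↔ Finite (Clopens X) := by
  constructor
  · intro h
    obtain ⟨e⟩ := nonempty_clopens_equiv_set (X := X)
    exact Finite.of_equiv _ e.symm
  · intro h
    by_contra hinf
    rw [not_finite_iff_infinite] at hinf
    obtain ⟨U, hU, hne, hdisj, -⟩ :=
      ConnectedComponents.exists_fun_isClopen_of_infinite X (Nat.card (Clopens X) + 1)
        (Nat.succ_pos _)
    have hinj : Function.Injective fun i => (⟨U i, hU i⟩ : Clopens X) := by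
      intro i j hij
      by_contra hc
      have h1 : U i = U j := congrArg Clopens.carrier hij
      have h2 := hdisj hc
      rw [Function.onFun, ← h1, disjoint_self] at h2
      exact (hne i).ne_empty h2
    have := Nat.card_le_card_of_injective _ hinj
    simp at this

theorem card_clopens_eq [Finite (ConnectedComponents X)] :
    Nat.card (Clopens X) = 2 ^ Nat.card (ConnectedComponents X) := by
  obtain ⟨e⟩ := nonempty_clopens_equiv_set (X := X)
  have := Fintype.ofFinite (ConnectedComponents X)
  rw [Nat.card_congr e, Nat.card_eq_fintype_card, Nat.card_eq_fintype_card, Fintype.card_set]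

end Topology

theorem charZero_of_isFormallyReal (K : Type*) [Field K] [IsFormallyReal K] : CharZero K := by
  obtain ⟨P, hP⟩ := exists_isOrdering K
  obtain ⟨_, _, -⟩ := exists_linearOrder P hP
  infer_instance

theorem posUnits_le_posNegUnits (K : Type*) [Field K] : posUnits K ≤ posNegUnits K :=
  fun _ h => Or.inl h

theorem relIndex_posUnits_posNegUnits (K : Type*) [Field K] [IsFormallyReal K] :
    (posUnits K).relIndex (posNegUnits K) = 2 := by
  rw [Subgroup.relIndex, Subgroup.index_eq_two_iff]
  refine ⟨⟨-1, Or.inr (by rw [neg_neg]; exact one_mem _)⟩, fun ⟨b, hb⟩ => ?_⟩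
  have h1 : ∀ b : (holomorphyRing K)ˣ, b ∈ posUnits K → -b ∉ posUnits K := by
    intro b hb hb'
    have h1 : (((b : holomorphyRing K) : K)) ∈ sumPow K 2 := hb
    have h2 : -(((b : holomorphyRing K) : K)) ∈ sumPow K 2 := hb'
    have h3 := IsFormallyReal.eq_zero_of_isSumSq_of_neg_isSumSq
      (mem_sumPow_two_iff.1 h1) (mem_sumPow_two_iff.1 h2)
    exact b.ne_zero (Subtype.ext h3)
  rw [Subgroup.mem_subgroupOf, Subgroup.mem_subgroupOf]
  simp only [Subgroup.coe_mul, mul_neg, mul_one]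
  rcases hb with hb | hb
  · exact Or.inr ⟨hb, h1 b hb⟩
  · exact Or.inl ⟨hb, by simpa using h1 _ hb⟩

end

end RealPlaces

theorem mainTheorem2 (K : Type*) [Field K] [IsFormallyReal K] :
    -- `|π₀(M(K))| = 1 + log₂ [(K*² ∩ ∑ K⁴) : (∑ K*²)²]`, with values in `ℕ ∪ {∞}`
    ((Finite (ConnectedComponents (RealPlaces.placeSpace K)) ↔
        Finite (RealPlaces.squaresSumFourth K ⧸
          (RealPlaces.squaresOfSumSq K).subgroupOf (RealPlaces.squaresSumFourth K))) ∧
      (Finite (ConnectedComponents (RealPlaces.placeSpace K)) →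
        (Nat.card (ConnectedComponents (RealPlaces.placeSpace K)) : ℝ) =
          1 + Real.logb 2 (Nat.card (RealPlaces.squaresSumFourth K ⧸
            (RealPlaces.squaresOfSumSq K).subgroupOf (RealPlaces.squaresSumFourth K))))) ∧
    -- `|π₀(M(K))| = log₂ [E : E⁺]`, with values in `ℕ ∪ {∞}`
    ((Finite (ConnectedComponents (RealPlaces.placeSpace K)) ↔
        Finite ((RealPlaces.holomorphyRing K)ˣ ⧸ RealPlaces.posUnits K)) ∧
      (Finite (ConnectedComponents (RealPlaces.placeSpace K)) →
        (Nat.card (ConnectedComponents (RealPlaces.placeSpace K)) : ℝ) =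
          Real.logb 2 (Nat.card ((RealPlaces.holomorphyRing K)ˣ ⧸ RealPlaces.posUnits K)))) ∧
    -- `(K*² ∩ ∑ K⁴) / (∑ K*²)² ≃ E / (E⁺ ∪ -E⁺)`
    Nonempty ((RealPlaces.squaresSumFourth K ⧸
        (RealPlaces.squaresOfSumSq K).subgroupOf (RealPlaces.squaresSumFourth K)) ≃*
      (RealPlaces.holomorphyRing K)ˣ ⧸ RealPlaces.posNegUnits K) := by
  have := RealPlaces.charZero_of_isFormallyReal K
  obtain ⟨φ⟩ := RealPlaces.nonempty_mulEquiv K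
  let ψ := RealPlaces.quotientPosUnitsEquiv K
  have hfin : Finite (ConnectedComponents (RealPlaces.placeSpace K)) ↔
      Finite ((RealPlaces.holomorphyRing K)ˣ ⧸ RealPlaces.posUnits K) :=
    RealPlaces.finite_connectedComponents_iff_finite_clopens.trans ψ.finite_iff.symm
  -- `[E : E⁺] = 2 [E : E⁺ ∪ -E⁺]`, also when these indices are infinite and `index` is `0`.
  have hindex : 2 * (RealPlaces.posNegUnits K).index = (RealPlaces.posUnits K).index := by
    rw [← RealPlaces.relIndex_posUnits_posNegUnits K]
    exact Subgroup.relIndex_mul_index (RealPlaces.posUnits_le_posNegUnits K)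
  have hfin' : Finite ((RealPlaces.holomorphyRing K)ˣ ⧸ RealPlaces.posUnits K) ↔
      Finite ((RealPlaces.holomorphyRing K)ˣ ⧸ RealPlaces.posNegUnits K) := by
    rw [← Subgroup.finiteIndex_iff_finite_quotient, ← Subgroup.finiteIndex_iff_finite_quotient,
      Subgroup.finiteIndex_iff, Subgroup.finiteIndex_iff, ← hindex]
    simp
  have hcard : Finite (ConnectedComponents (RealPlaces.placeSpace K)) →
      (RealPlaces.posUnits K).index =
        2 ^ Nat.card (ConnectedComponents (RealPlaces.placeSpace K)) := fun h => by
    rw [← RealPlaces.card_clopens_eq]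
    exact Nat.card_congr ψ
  refine ⟨⟨hfin.trans (hfin'.trans φ.toEquiv.finite_iff.symm), fun h => ?_⟩, ⟨hfin, fun h => ?_⟩,
    ⟨φ⟩⟩
  · have h1 := (hindex.trans (hcard h))
    rw [Nat.card_congr φ.toEquiv]
    change _ = 1 + Real.logb 2 ((RealPlaces.posNegUnits K).index)
    have h2 : (2 : ℝ) * (RealPlaces.posNegUnits K).index =
        2 ^ Nat.card (ConnectedComponents (RealPlaces.placeSpace K)) := by exact_mod_cast h1
    have h3 : ((RealPlaces.posNegUnits K).index : ℝ) ≠ 0 := by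
      intro h0
      rw [h0, mul_zero] at h2
      exact (pow_ne_zero _ two_ne_zero) h2.symm
    have h4 := congrArg (Real.logb 2) h2
    rw [Real.logb_mul two_ne_zero h3, Real.logb_pow, Real.logb_self_eq_one one_lt_two,
      mul_one] at h4
    exact h4.symm
  · change _ = Real.logb 2 ((RealPlaces.posUnits K).index)
    rw [hcard h]
    push_cast
    rw [Real.logb_pow, Real.logb_self_eq_one one_lt_two, mul_one]
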